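/- Let $X \subseteq \{0,1\}^{\mathbb N}$, where $\{0,1\}^{\mathbb N}$ is the Cantor space. Let $\{0,1\}^*$ be the set of finite sequences of elements of $\{0,1\}$, and for $x \in X$ let $A_x \subseteq \{0,1\}^*$ be the set of finite initial segments of $x$. Equip the disjoint union $X \cup \{0,1\}^*$ with the topology in which the points of $\{0,1\}^*$ are isolated and, for each $x \in X$, a neighborhood base at $x$ is given by the sets $\{x\} \cup B$ with $B$ a cofinite subset of $A_x$. Let $\mathrm{T}(X)$ be the one-point compactification of this space. Then the following assertions are equivalent: 1. The space $\mathrm{T}(X)$ is an $\alpha_1$ space: for every point $p \in \mathrm{T}(X)$ and all sequences $s_1, s_2, \dots$ in $\mathrm{T}(X)$ converging to $p$, there is a sequence $s$ in $\mathrm{T}(X)$ converging to $p$ such that for each $n$ the set $\operatorname{im}(s_n) \setminus \operatorname{im}(s)$ is finite. 2. Every Borel image of $X$ in the Baire space $\mathbb N^{\mathbb N}$ is bounded: for every Borel map $\Psi \colon X \to \mathbb N^{\mathbb N}$ (with $X$ carrying the subspace topology) there is $g \in \mathbb N^{\mathbb N}$ such that for each $x \in X$ we have $\Psi(x)(n)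 \le g(n)$ for all but finitely many $n$. -/

import Mathlib

open Set Filter Topology

/-- Arhangel'skii's property `α₁`: for every sequence of sequences converging to the same point
`p`, there is a sequence converging to `p` whose image contains all but finitely many elements of
the image of each of the given sequences. -/
def IsAlphaOne (Y : Type*) [TopologicalSpace Y] : Prop :=
  ∀ (p : Y) (s : ℕ → ℕ → Y), (∀ n, Tendsto (s n) atTop (𝓝 p)) →
    ∃ t : ℕ → Y, Tendsto t atTop (𝓝 p) ∧ ∀ n, (range (s n) \ range t).Finite

/-- A subset of the Baire space is bounded if it is bounded with respect to eventual dominance. -/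
def EventuallyBounded (B : Set (ℕ → ℕ)) : Prop :=
  ∃ g : ℕ → ℕ, ∀ f ∈ B, ∀ᶠ n in atTop, f n ≤ g n

/-- Every Borel image of the space `X` in the Baire space is bounded. -/
def BorelImagesBounded (X : Type*) [TopologicalSpace X] [MeasurableSpace X] [BorelSpace X] :
    Prop :=
  ∀ Ψ : X → (ℕ → ℕ), Measurable Ψ → EventuallyBounded (range Ψ)

/-- The set `A_x` of the finite initial segments of the infinite binary sequence `x`. -/
def initialSegments (x : ℕ → Bool) : Set (List Bool) :=
  {l | ∃ n : ℕ, l = List.ofFn (fun i : Fin n => x i)}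

/-- The disjoint union of the set `X` and the set `{0,1}*` of finite binary sequences. -/
inductive PointsAndNodes (X : Set (ℕ → Bool)) : Type
  | point (x : X) : PointsAndNodes X
  | node (l : List Bool) : PointsAndNodes X

namespace PointsAndNodes

variable {X : Set (ℕ → Bool)}

/-- A set is open if, with every point `x` of `X` in it, it contains all but finitely many of the
initial segments of `x`. See `nhds_node` and `hasBasis_nhds_point` for the neighborhoods. -/
instance : TopologicalSpace (PointsAndNodes X) where
  IsOpen U := ∀ x : X, point x ∈ U → {l | l ∈ initialSegments x ∧ node l ∉ U}.Finite
  isOpen_univ := by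
    intro x _
    simp
  isOpen_inter := by
    intro U V hU hV x hx
    refine ((hU x hx.1).union (hV x hx.2)).subset ?_
    rintro l ⟨hl, hn⟩
    by_cases h : node l ∈ U
    · exact Or.inr ⟨hl, fun hv => hn ⟨h, hv⟩⟩
    · exact Or.inl ⟨hl, h⟩
  isOpen_sUnion := by
    rintro S hS x ⟨U, hU, hx⟩
    refine (hS U hU x hx).subset ?_
    rintro l ⟨hl, hn⟩
    exact ⟨hl, fun h => hn ⟨U, hU, h⟩⟩

theorem isOpen_iff {U : Set (PointsAndNodes X)} :
    IsOpen U ↔ ∀ x : X, point x ∈ U → {l | l ∈ initialSegments x ∧ node l ∉ U}.Finite :=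
  Iff.rfl

/-- The points of `{0,1}*` are isolated. -/
theorem nhds_node (l : List Bool) : 𝓝 (node l : PointsAndNodes X) = pure (node l) := by
  have h : IsOpen ({node l} : Set (PointsAndNodes X)) := by
    rw [isOpen_iff]
    intro x hx
    simp at hx
  exact (isOpen_singleton_iff_nhds_eq_pure _).1 h

/-- A neighborhood base of `x ∈ X` is given by the sets `{x} ∪ B` with `B` a cofinite subset of
the set of initial segments of `x`. -/
theorem hasBasis_nhds_point (x : X) :
    (𝓝 (point x : PointsAndNodes X)).HasBasis
      (fun B : Set (List Bool) => B ⊆ initialSegments x ∧ (initialSegments x \ B).Finite)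
      (fun B => {point x} ∪ node '' B) := by
  refine ⟨fun U => ?_⟩
  rw [mem_nhds_iff]
  constructor
  · rintro ⟨V, hVU, hV, hx⟩
    refine ⟨{l | l ∈ initialSegments x ∧ node l ∈ V}, ⟨fun l hl => hl.1, ?_⟩, ?_⟩
    · refine (isOpen_iff.1 hV x hx).subset ?_
      rintro l ⟨hl, hn⟩
      exact ⟨hl, fun h => hn ⟨hl, h⟩⟩
    · rintro y (rfl | ⟨l, hl, rfl⟩)
      · exact hVU hx
      · exact hVU hl.2
  · rintro ⟨B, ⟨_, hfin⟩, hBU⟩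
    refine ⟨_, hBU, ?_, Or.inl rfl⟩
    rw [isOpen_iff]
    intro y hy
    have hyx : y = x := by simpa using hy
    subst hyx
    refine hfin.subset ?_
    rintro l ⟨hl, hn⟩
    exact ⟨hl, fun h => hn (Or.inr ⟨l, h, rfl⟩)⟩

end PointsAndNodes

/-- The space `T(X)`: the one-point compactification of the space `X ∪ {0,1}*`. -/
abbrev GerlitsNagySpace (X : Set (ℕ → Bool)) : Type := OnePoint (PointsAndNodes X)

/-!
Call a set `N` of nodes of the binary tree *orthogonal* to `X` if every `x ∈ X` has only finitely
many initial segments in `N`. A set of points and nodes, enumerated without repetition, converges to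
`∞` in `T(X)` exactly when its nodes form an orthogonal set, and at all other points `T(X)` has
countable neighborhood bases. Hence `T(X)` is `α₁` if and only if every sequence of orthogonal sets
`N n` has an orthogonal set `T` with all `N n \ T` finite.

If Borel images of `X` are bounded, apply this to the map `Ψ` that sends `x` to the sequence of
levels `Ψ x n` from which on `x` has no initial segment in `N n`. A bound `g` of its range yields the
set `T` of those nodes of `N n`, for some `n`, that have length at least `g n`
(`isAlphaOne_of_borelImagesBounded`).

For the converse, let `D n` be, for each `n`, an increasing sequence of closed sets that covers `X`.
For each `m`, the minimal nodes of length at least `m` whose cylinder misses `D n m` form an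
antichain, and the union `N n` of these antichains over `m` is orthogonal. A set `T` that amalgamates
the `N n` provides a single `g` such that each `x ∈ X` belongs to `D n (g n)` for almost all `n`
(`IsAlphaOne.closedCoverSelection`). This selection principle implies that every `Gδ` subset of `X`
is an `Fσ`, hence that all Borel subsets of `X` are `Fσ` (`ClosedCoverSelection.isGδ_compl` and
`ClosedCoverSelection.isGδ_compl_of_measurableSet`). The sets `{x | Ψ x n ≤ m}` for a Borel map `Ψ`
can then be shrunk to increasing closed covers, and the selection principle bounds the range of `Ψ`.
-/

/-! ### The selection principle for closed covers -/

/-- The selection principle for increasing closed covers: from countably many countable increasing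
closed covers one can select one member each so that every point lies in almost all of the selected
sets. -/
def ClosedCoverSelection (Y : Type*) [TopologicalSpace Y] : Prop :=
  ∀ D : ℕ → ℕ → Set Y, (∀ n m, IsClosed (D n m)) → (∀ n, Monotone (D n)) →
    (∀ n y, ∃ m, y ∈ D n m) → ∃ g : ℕ → ℕ, ∀ y, ∀ᶠ n in atTop, y ∈ D n (g n)

/-- The complement of a `Gδ` set is the union of an increasing sequence of closed sets. -/
theorem IsGδ.exists_monotone_isClosed_compl {Y : Type*} [TopologicalSpace Y] {A : Set Y}
    (hA : IsGδ A) :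
    ∃ C : ℕ → Set Y, (∀ k, IsClosed (C k)) ∧ Monotone C ∧ ∀ y, y ∉ A ↔ ∃ k, y ∈ C k := by
  obtain ⟨f, hf, rfl⟩ := hA.eq_iInter_nat
  refine ⟨fun k => ⋃ i ∈ Finset.range (k + 1), (f i)ᶜ, fun k => ?_, fun a b hab => ?_, fun y => ?_⟩
  · exact isClosed_biUnion_finset fun i _ => (hf i).isClosed_compl
  · refine biUnion_subset_biUnion_left fun i hi => ?_
    simp only [Finset.mem_coe, Finset.mem_range] at hi ⊢
    omega
  · simp only [mem_iInter, not_forall, mem_iUnion, Finset.mem_range, mem_compl_iff, exists_prop]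
    exact ⟨fun ⟨i, hi⟩ => ⟨i, i, by omega, hi⟩, fun ⟨_, i, _, hi⟩ => ⟨i, hi⟩⟩

namespace ClosedCoverSelection

/-- Every `Gδ` set is an `Fσ` set: apply the selection principle to the covers consisting of the
complement of the `n`-th open set together with the members of an increasing closed exhaustion of
that open set. -/
theorem isGδ_compl {Y : Type*} [TopologicalSpace Y] [PerfectlyNormalSpace Y]
    (hY : ClosedCoverSelection Y) {A : Set Y} (hA : IsGδ A) : IsGδ Aᶜ := by
  obtain ⟨f, hf, rfl⟩ := hA.eq_iInter_nat
  have hC := fun n => (hf n).isClosed_compl.isGδ.exists_monotone_isClosed_compl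
  choose C hCc hCm hCmem using hC
  obtain ⟨g, hg⟩ := hY (fun n m => (f n)ᶜ ∪ C n m)
    (fun n m => (hf n).isClosed_compl.union (hCc n m))
    (fun n a b hab => union_subset_union_right _ (hCm n hab))
    (fun n y => by
      by_cases hy : y ∈ f n
      · obtain ⟨k, hk⟩ := (hCmem n y).1 (by simpa using hy)
        exact ⟨k, Or.inr hk⟩
      · exact ⟨0, Or.inl hy⟩)
  -- The first `k` open sets are retained in the `k`-th piece, since `f` need not be decreasing.
  have key : (⋂ n, f n)ᶜ = ⋂ k, ((⋂ i ∈ Finset.range k, f i) ∩ ⋂ n ≥ k, C n (g n))ᶜ := by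
    ext y
    rw [mem_compl_iff, mem_iInter, mem_iInter, not_iff_comm, not_forall]
    simp only [mem_compl_iff, not_not, mem_inter_iff, mem_iInter, Finset.mem_range]
    constructor
    · rintro ⟨k, hk1, hk2⟩ n
      rcases lt_or_ge n k with h | h
      · exact hk1 n h
      · simpa using (hCmem n y).2 ⟨_, hk2 n h⟩
    · intro hy
      obtain ⟨k, hk⟩ := eventually_atTop.1 (hg y)
      exact ⟨k, fun i _ => hy i, fun n hn => (hk n hn).resolve_left fun h => h (hy n)⟩
  rw [key]
  refine IsGδ.iInter fun k => ?_
  rw [compl_inter]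
  refine IsGδ.union ?_ (isClosed_biInter fun n _ => hCc n (g n)).isOpen_compl.isGδ
  rw [compl_iInter₂]
  exact IsGδ.biUnion (Finset.finite_toSet _) fun i _ => (hf i).isClosed_compl.isGδ

/-- Every Borel set is an `Fσ` set. -/
theorem isGδ_compl_of_measurableSet {Y : Type*} [TopologicalSpace Y] [PerfectlyNormalSpace Y]
    [MeasurableSpace Y] [BorelSpace Y] (hY : ClosedCoverSelection Y) {A : Set Y}
    (hA : MeasurableSet A) : IsGδ Aᶜ := by
  induction A, hA using MeasurableSet.induction_on_open with
  | isOpen U hU => exact hU.isClosed_compl.isGδ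
  | compl s _ ih => exact hY.isGδ_compl ih
  | iUnion f _ _ ih =>
    rw [compl_iUnion]
    exact IsGδ.iInter ih

theorem borelImagesBounded {Y : Type*} [TopologicalSpace Y] [PerfectlyNormalSpace Y]
    [MeasurableSpace Y] [BorelSpace Y] (hY : ClosedCoverSelection Y) : BorelImagesBounded Y := by
  intro Ψ hΨ
  have hC : ∀ n m, ∃ C : ℕ → Set Y, (∀ k, IsClosed (C k)) ∧ Monotone C ∧
      ∀ y, Ψ y n ≤ m ↔ ∃ k, y ∈ C k := by
    intro n m
    have hmeas : MeasurableSet {y | Ψ y n ≤ m} :=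
      measurableSet_le ((measurable_pi_apply n).comp hΨ) measurable_const
    obtain ⟨C, h1, h2, h3⟩ :=
      (hY.isGδ_compl_of_measurableSet hmeas).exists_monotone_isClosed_compl
    exact ⟨C, h1, h2, fun y => by simpa using h3 y⟩
  choose C hCc hCm hCmem using hC
  -- Diagonal unions turn the covers by `Fσ` sets into finer increasing covers by closed sets.
  obtain ⟨g, hg⟩ := hY (fun n m => ⋃ j ∈ Finset.range (m + 1), C n j m)
    (fun n m => isClosed_biUnion_finset fun j _ => hCc n j m)
    (fun n a b hab => by
      refine biUnion_mono (fun i hi => ?_) fun j _ => hCm n j hab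
      simp only [Finset.mem_coe, Finset.mem_range] at hi ⊢
      omega)
    (fun n y => by
      obtain ⟨k, hk⟩ := (hCmem n (Ψ y n) y).1 le_rfl
      refine ⟨max (Ψ y n) k, mem_biUnion (x := Ψ y n) ?_ (hCm n _ (le_max_right _ _) hk)⟩
      simp only [Finset.mem_coe, Finset.mem_range]
      omega)
  refine ⟨g, ?_⟩
  rintro _ ⟨y, rfl⟩
  filter_upwards [hg y] with n hn
  simp only [mem_iUnion, Finset.mem_range, exists_prop] at hn
  obtain ⟨j, hj, hy⟩ := hn
  exact ((hCmem n j y).2 ⟨_, hy⟩).trans (by omega)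

end ClosedCoverSelection

/-! ### Initial segments and orthogonal sets of nodes -/

/-- The initial segment of length `n` of the infinite binary sequence `x`. -/
def initialSegment (x : ℕ → Bool) (n : ℕ) : List Bool := List.ofFn (fun i : Fin n => x i)

@[simp]
theorem length_initialSegment (x : ℕ → Bool) (n : ℕ) : (initialSegment x n).length = n := by
  simp [initialSegment]

theorem initialSegments_eq_range (x : ℕ → Bool) : initialSegments x = range (initialSegment x) := by
  ext l
  exact ⟨fun ⟨n, h⟩ => ⟨n, h.symm⟩, fun ⟨n, h⟩ => ⟨n, h.symm⟩⟩

theorem initialSegment_injective (x : ℕ → Bool) : Function.Injective (initialSegment x) :=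
  fun m n h => by simpa using congrArg List.length h

theorem initialSegment_eq_iff {x y : ℕ → Bool} {m n : ℕ} :
    initialSegment x m = initialSegment y n ↔ m = n ∧ ∀ i < m, x i = y i := by
  constructor
  · intro h
    obtain rfl : m = n := by simpa using congrArg List.length h
    refine ⟨rfl, fun i hi => ?_⟩
    exact congrFun (List.ofFn_injective h) ⟨i, hi⟩
  · rintro ⟨rfl, h⟩
    exact congrArg List.ofFn (funext fun i => h i i.2)

/-- A set of nodes of the binary tree is orthogonal to `X` if every `x ∈ X` has only finitely many
initial segments in it. The initial segments are counted by their lengths. -/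
def IsOrthogonal (X : Set (ℕ → Bool)) (N : Set (List Bool)) : Prop :=
  ∀ x ∈ X, {k | initialSegment x k ∈ N}.Finite

/-- The nodes in a subset of `T(X)`. -/
def nodesOf {X : Set (ℕ → Bool)} (S : Set (GerlitsNagySpace X)) : Set (List Bool) :=
  {l | ((PointsAndNodes.node l : PointsAndNodes X) : GerlitsNagySpace X) ∈ S}

/-! ### Convergence in `T(X)` -/

namespace PointsAndNodes

theorem nhds_point {X : Set (ℕ → Bool)} (x : X) :
    𝓝 (point x : PointsAndNodes X) =
      pure (point x) ⊔ map (fun n => node (initialSegment x n)) atTop := by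
  refine (hasBasis_nhds_point x).ext (((hasBasis_pure _).sup (atTop_basis.map _)))
    (fun B hB => ?_) fun k _ => ?_
  · have hfin : {n | initialSegment x n ∉ B}.Finite := by
      refine (hB.2.preimage (initialSegment_injective x).injOn).subset fun n hn => ?_
      exact ⟨initialSegments_eq_range (x : ℕ → Bool) ▸ mem_range_self n, hn⟩
    obtain ⟨k, hk⟩ := hfin.bddAbove
    refine ⟨⟨(), k + 1⟩, ⟨trivial, trivial⟩, union_subset_union_right _ ?_⟩
    rintro _ ⟨n, hn, rfl⟩
    refine mem_image_of_mem _ (by_contra fun h => ?_)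
    have h1 := hk h
    simp only [mem_Ici] at hn
    omega
  · refine ⟨initialSegment x '' Ici k.2, ⟨?_, ?_⟩, ?_⟩
    · rw [initialSegments_eq_range]
      exact image_subset_range _ _
    · refine ((finite_Iio k.2).image (initialSegment x)).subset ?_
      rw [initialSegments_eq_range]
      rintro _ ⟨⟨n, rfl⟩, hn⟩
      exact mem_image_of_mem _ (mem_Iio.2 (not_le.1 fun h => hn (mem_image_of_mem _ h)))
    · rw [image_image]

instance firstCountableTopology (X : Set (ℕ → Bool)) :
    FirstCountableTopology (PointsAndNodes X) where
  nhds_generated_countable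
    | point x => by rw [nhds_point]; infer_instance
    | node l => by rw [nhds_node]; infer_instance

/-- A compact set contains only finitely many elements of a set whose nodes form an orthogonal set,
since every element of the space has a neighborhood with this property. -/
theorem finite_inter_of_isCompact {X : Set (ℕ → Bool)} {S K : Set (PointsAndNodes X)}
    (hS : IsOrthogonal X {l | node l ∈ S}) (hK : IsCompact K) : (S ∩ K).Finite := by
  refine hK.induction_on (p := fun K => (S ∩ K).Finite) (by simp)
    (fun s t hst ht => ht.subset (inter_subset_inter_right _ hst))
    (fun s t hs ht => by rw [inter_union_distrib_left]; exact hs.union ht) ?_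
  rintro (x | l) -
  · refine ⟨{point x} ∪ range fun n => node (initialSegment x n), mem_nhdsWithin_of_mem_nhds ?_, ?_⟩
    · rw [nhds_point, mem_sup, mem_pure, mem_map]
      exact ⟨Or.inl rfl, univ_mem' fun n => Or.inr (mem_range_self n)⟩
    · refine ((finite_singleton (point x)).union
        ((hS x x.2).image fun n => node (initialSegment x n))).subset ?_
      rintro _ ⟨hy, rfl | ⟨n, rfl⟩⟩
      · exact Or.inl rfl
      · exact Or.inr (mem_image_of_mem (fun n => node (initialSegment x n)) hy)
  · refine ⟨{node l}, mem_nhdsWithin_of_mem_nhds ?_, (finite_singleton (node l)).subset ?_⟩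
    · simp [nhds_node]
    · exact inter_subset_right

/-- The set `{x} ∪ A_x`, a convergent sequence together with its limit. -/
def branch {X : Set (ℕ → Bool)} (x : X) : Set (PointsAndNodes X) :=
  insert (point x) (range fun n => node (initialSegment x n))

theorem isCompact_branch {X : Set (ℕ → Bool)} (x : X) : IsCompact (branch x) := by
  refine Tendsto.isCompact_insert_range ?_
  rw [nhds_point]
  exact le_sup_right

theorem isClosed_branch {X : Set (ℕ → Bool)} (x : X) : IsClosed (branch x) := by
  rw [← isOpen_compl_iff, isOpen_iff]
  intro y hy
  have hne : (y : ℕ → Bool) ≠ x := fun h => hy (Or.inl (congrArg point (Subtype.ext h)))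
  obtain ⟨i, hi⟩ := Function.ne_iff.1 hne
  refine ((finite_Iic i).image (initialSegment y)).subset ?_
  rw [initialSegments_eq_range]
  rintro _ ⟨⟨n, rfl⟩, hn⟩
  refine mem_image_of_mem _ (mem_Iic.2 (not_lt.1 fun hin => hi ?_))
  rcases not_not.1 hn with h | ⟨m, hm⟩
  · cases h
  · have hm' : initialSegment x m = initialSegment y n := node.inj hm
    obtain ⟨rfl, h⟩ := initialSegment_eq_iff.1 hm'
    exact (h i hin).symm

end PointsAndNodes

open PointsAndNodes

/-- The nodes of a sequence that converges to `∞` form an orthogonal set, since the compact sets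
`{x} ∪ A_x` contain only finitely many of its terms. -/
theorem isOrthogonal_nodesOf_range {X : Set (ℕ → Bool)} {t : ℕ → GerlitsNagySpace X}
    (ht : Tendsto t atTop (𝓝 OnePoint.infty)) : IsOrthogonal X (nodesOf (range t)) := by
  intro x hx
  have hU : IsOpen ((OnePoint.some '' branch (⟨x, hx⟩ : X))ᶜ : Set (GerlitsNagySpace X)) :=
    OnePoint.isOpen_compl_image_coe.2 ⟨isClosed_branch _, isCompact_branch _⟩
  have hmem := ht (hU.mem_nhds OnePoint.infty_notMem_image_coe)
  obtain ⟨k, hk⟩ := mem_atTop_sets.1 hmem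
  refine (((finite_Iio k).image t).preimage (f := fun n =>
    ((node (initialSegment x n) : PointsAndNodes X) : GerlitsNagySpace X)) ?_).subset ?_
  · intro m _ n _ h
    exact initialSegment_injective x (node.inj (OnePoint.coe_injective h))
  · rintro n ⟨i, hi⟩
    refine ⟨i, not_le.1 fun h => hk i h ?_, hi⟩
    rw [hi]
    exact mem_image_of_mem _ (Or.inr (mem_range_self n))

/-- The elements of a countable set of points and nodes whose nodes form an orthogonal set are among
the terms of a sequence that converges to `∞`. -/
theorem exists_tendsto_infty_of_isOrthogonal {X : Set (ℕ → Bool)} {S : Set (PointsAndNodes X)}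
    (hc : S.Countable) (hS : IsOrthogonal X {l | node l ∈ S}) :
    ∃ t : ℕ → GerlitsNagySpace X, Tendsto t atTop (𝓝 OnePoint.infty) ∧
      OnePoint.some '' S ⊆ range t := by
  classical
  obtain ⟨e, he⟩ := countable_iff_exists_injOn.1 hc
  let t : ℕ → GerlitsNagySpace X := fun n =>
    if h : ∃ s ∈ S, e s = n then (h.choose : GerlitsNagySpace X) else OnePoint.infty
  have ht : ∀ n, (∃ s ∈ S, e s = n ∧ t n = s) ∨ t n = OnePoint.infty := fun n => by
    by_cases h : ∃ s ∈ S, e s = n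
    · exact Or.inl ⟨h.choose, h.choose_spec.1, h.choose_spec.2, dif_pos h⟩
    · exact Or.inr (dif_neg h)
  refine ⟨t, ?_, ?_⟩
  · rw [OnePoint.hasBasis_nhds_infty.tendsto_right_iff]
    rintro K ⟨-, hK⟩
    rw [← Nat.cofinite_eq_atTop]
    refine ((finite_inter_of_isCompact hS hK).image e).subset fun n hn => ?_
    rcases ht n with ⟨s, hs, hsn, hts⟩ | hinf
    · exact ⟨s, ⟨hs, by_contra fun h => hn (Or.inl ⟨s, h, hts.symm⟩)⟩, hsn⟩
    · exact (hn (Or.inr hinf)).elim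
  · rintro _ ⟨s, hs, rfl⟩
    have h : ∃ s' ∈ S, e s' = e s := ⟨s, hs, rfl⟩
    have hts : t (e s) = h.choose := dif_pos h
    exact ⟨e s, hts.trans (congrArg _ (he h.choose_spec.1 hs h.choose_spec.2))⟩

/-! ### Bounded Borel images imply `α₁` -/

/-- The property `α₁` holds at every point with a countable neighborhood base: if `B` is a
decreasing one, merge the parts of the sequences `s n` that lie in `B n`. -/
theorem exists_tendsto_amalgamation {Y : Type*} [TopologicalSpace Y] {p : Y}
    [(𝓝 p).IsCountablyGenerated] {s : ℕ → ℕ → Y} (hs : ∀ n, Tendsto (s n) atTop (𝓝 p)) :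
    ∃ t : ℕ → Y, Tendsto t atTop (𝓝 p) ∧ ∀ n, (range (s n) \ range t).Finite := by
  classical
  obtain ⟨B, hB⟩ := (𝓝 p).exists_antitone_basis
  have hfin : ∀ n k, {i | s n i ∉ B k}.Finite := fun n k => by
    have h : ∀ᶠ i in cofinite, s n i ∈ B k := by
      rw [Nat.cofinite_eq_atTop]
      exact hs n (hB.mem k)
    exact h
  let u : ℕ × ℕ → Y := fun q => if s q.1 q.2 ∈ B q.1 then s q.1 q.2 else p
  have hu : Tendsto u cofinite (𝓝 p) := by
    rw [hB.toHasBasis.tendsto_right_iff]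
    intro k _
    refine (((finite_Iio k).biUnion fun n _ => (hfin n k).image (Prod.mk n))).subset ?_
    rintro ⟨n, i⟩ h
    have hni : ¬ u (n, i) ∈ B k := h
    by_cases hB' : s n i ∈ B n
    · simp only [u, if_pos hB'] at hni
      have hnk : n < k := not_le.1 fun hkn => hni (hB.antitone hkn hB')
      exact mem_biUnion (x := n) hnk (mem_image_of_mem _ hni)
    · simp only [u, if_neg hB'] at hni
      exact (hni (mem_of_mem_nhds (hB.mem k))).elim
  refine ⟨u ∘ Nat.pairEquiv.symm, ?_, fun n => ?_⟩
  · rw [← Nat.cofinite_eq_atTop]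
    exact hu.comp Nat.pairEquiv.symm.injective.tendsto_cofinite
  · refine ((hfin n n).image (s n)).subset ?_
    rintro _ ⟨⟨i, rfl⟩, hi⟩
    refine mem_image_of_mem _ fun h => hi ?_
    rw [Nat.pairEquiv.symm.surjective.range_comp]
    exact ⟨(n, i), if_pos h⟩

/-- Countably many orthogonal sets of nodes can be amalgamated, by deleting from the `n`-th one the
nodes of length less than some `g n`. -/
theorem exists_isOrthogonal_amalgamation {X : Set (ℕ → Bool)} (hX : BorelImagesBounded X)
    {N : ℕ → Set (List Bool)} (hN : ∀ n, IsOrthogonal X (N n)) :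
    ∃ g : ℕ → ℕ, IsOrthogonal X {l | ∃ n, l ∈ N n ∧ g n ≤ l.length} := by
  classical
  have hp : ∀ n, ∀ x : X, ∃ m, ∀ k ≥ m, initialSegment x k ∉ N n := fun n x => by
    obtain ⟨b, hb⟩ := (hN n x x.2).bddAbove
    refine ⟨b + 1, fun k hk h => ?_⟩
    have h1 := hb h
    omega
  obtain ⟨g, hg⟩ := hX (fun x n => Nat.find (hp n x)) (by
    refine measurable_pi_iff.2 fun n => measurable_find (hp n) fun m => ?_
    simp only [ofPred_forall]
    refine MeasurableSet.iInter fun k => MeasurableSet.iInter fun _ => ?_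
    have hmeas : Measurable fun x : X => fun i : Fin k => (x : ℕ → Bool) i :=
      measurable_pi_iff.2 fun i => (measurable_pi_apply _).comp measurable_subtype_coe
    exact hmeas (Set.toFinite {v : Fin k → Bool | List.ofFn v ∉ N n}).measurableSet)
  refine ⟨g, fun x hx => ?_⟩
  obtain ⟨n₀, hn₀⟩ := eventually_atTop.1 (hg _ ⟨⟨x, hx⟩, rfl⟩)
  refine ((finite_Iio n₀).biUnion fun n _ => hN n x hx).subset ?_
  rintro k ⟨n, hkn, hk⟩
  rw [length_initialSegment] at hk
  refine mem_biUnion (x := n) (mem_Iio.2 (not_le.1 fun h => ?_)) hkn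
  exact Nat.find_spec (hp n ⟨x, hx⟩) k ((hn₀ n h).trans hk) hkn

theorem isAlphaOne_of_borelImagesBounded {X : Set (ℕ → Bool)} (hX : BorelImagesBounded X) :
    IsAlphaOne (GerlitsNagySpace X) := by
  intro p s hs
  induction p using OnePoint.rec with
  | coe y =>
    have : (𝓝 (y : GerlitsNagySpace X)).IsCountablyGenerated := by
      rw [OnePoint.nhds_coe_eq]
      infer_instance
    exact exists_tendsto_amalgamation hs
  | infty =>
    obtain ⟨g, hg⟩ := exists_isOrthogonal_amalgamation hX fun n => isOrthogonal_nodesOf_range (hs n)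
    -- All points of `X` in the given sequences are kept: they do not affect orthogonality.
    let S : Set (PointsAndNodes X) := {y | ∃ n, (y : GerlitsNagySpace X) ∈ range (s n) ∧
      ∀ l, y = node l → g n ≤ l.length}
    have hSc : S.Countable := by
      refine ((countable_iUnion fun n => countable_range (s n)).preimage
        (OnePoint.coe_injective (X := PointsAndNodes X))).mono ?_
      rintro y ⟨n, hn, -⟩
      exact mem_iUnion.2 ⟨n, hn⟩
    have hS : IsOrthogonal X {l | node l ∈ S} := fun x hx => by
      refine (hg x hx).subset ?_
      rintro k ⟨n, hn, hk⟩
      exact ⟨n, hn, hk _ rfl⟩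
    obtain ⟨t, ht, hSt⟩ := exists_tendsto_infty_of_isOrthogonal hSc hS
    refine ⟨t, ht, fun n => ?_⟩
    refine ((finite_singleton OnePoint.infty).union ((List.finite_length_lt Bool (g n)).image
      fun l => ((node l : PointsAndNodes X) : GerlitsNagySpace X))).subset ?_
    rintro y ⟨hy, hyt⟩
    induction y using OnePoint.rec with
    | infty => exact Or.inl rfl
    | coe y =>
      have hyS : y ∉ S := fun h => hyt (hSt (mem_image_of_mem _ h))
      have hex : ∃ l, y = node l ∧ l.length < g n := by
        by_contra! h
        exact hyS ⟨n, hy, h⟩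
      obtain ⟨l, rfl, hl⟩ := hex
      exact Or.inr (mem_image_of_mem
        (fun l => ((node l : PointsAndNodes X) : GerlitsNagySpace X)) hl)

/-! ### `α₁` implies the selection principle -/

theorem IsAlphaOne.exists_isOrthogonal {X : Set (ℕ → Bool)} (h : IsAlphaOne (GerlitsNagySpace X))
    {N : ℕ → Set (List Bool)} (hN : ∀ n, IsOrthogonal X (N n)) :
    ∃ T, IsOrthogonal X T ∧ ∀ n, (N n \ T).Finite := by
  have hs : ∀ n, ∃ t : ℕ → GerlitsNagySpace X, Tendsto t atTop (𝓝 OnePoint.infty) ∧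
      N n ⊆ nodesOf (range t) := fun n => by
    have hinj : Function.Injective (node : List Bool → PointsAndNodes X) := fun _ _ => node.inj
    obtain ⟨t, ht, hsub⟩ := exists_tendsto_infty_of_isOrthogonal (X := X)
      ((to_countable (N n)).image node) (by simpa [hinj.mem_set_image] using hN n)
    exact ⟨t, ht, fun l hl => hsub (mem_image_of_mem _ (mem_image_of_mem _ hl))⟩
  choose s hs hNs using hs
  obtain ⟨t, ht, hfin⟩ := h _ s hs
  refine ⟨_, isOrthogonal_nodesOf_range ht, fun n => ?_⟩
  refine ((hfin n).preimage (f := fun l =>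
    ((node l : PointsAndNodes X) : GerlitsNagySpace X)) ?_).subset fun l hl => ⟨hNs n hl.1, hl.2⟩
  intro a _ b _ hab
  exact node.inj (OnePoint.coe_injective hab)

/-- The lengths `k ≥ m` such that the cylinder of the initial segment of `x` of length `k` is
disjoint from `D`. -/
def missingLevels {X : Set (ℕ → Bool)} (D : Set X) (m : ℕ) (x : X) : Set ℕ :=
  {k | m ≤ k ∧ ∀ z : X, (∀ i < k, (z : ℕ → Bool) i = (x : ℕ → Bool) i) → z ∉ D}

theorem missingLevels_nonempty {X : Set (ℕ → Bool)} {D : Set X} (hD : IsClosed D) (m : ℕ) {x : X}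
    (hx : x ∉ D) : (missingLevels D m x).Nonempty := by
  obtain ⟨V, hV, hVD⟩ := isOpen_induced_iff.1 hD.isOpen_compl
  have hxV : (x : ℕ → Bool) ∈ V := by
    have h : x ∈ Subtype.val ⁻¹' V := hVD ▸ hx
    exact h
  obtain ⟨I, u, hu, hsub⟩ := isOpen_pi_iff.1 hV _ hxV
  refine ⟨max m (I.sup id + 1), le_max_left _ _, fun z hz => ?_⟩
  have h : z ∈ Subtype.val ⁻¹' V := by
    refine hsub fun i hi => ?_
    have h1 : i ≤ I.sup id := Finset.le_sup (f := id) hi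
    rw [hz i (by omega)]
    exact (hu i hi).2
  rwa [hVD] at h

/-- The minimal nodes of length at least `m` whose cylinder is disjoint from `D`. -/
def minimalMissingNodes {X : Set (ℕ → Bool)} (D : Set X) (m : ℕ) : Set (List Bool) :=
  {l | ∃ (y : X) (k : ℕ), l = initialSegment y k ∧ IsLeast (missingLevels D m y) k}

theorem initialSegment_mem_minimalMissingNodes {X : Set (ℕ → Bool)} {D : Set X} {m : ℕ} {x : X}
    {k : ℕ} : initialSegment x k ∈ minimalMissingNodes D m ↔ IsLeast (missingLevels D m x) k := by
  refine ⟨?_, fun h => ⟨x, k, rfl, h⟩⟩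
  rintro ⟨y, k', h, hk⟩
  obtain ⟨rfl, hxy⟩ := initialSegment_eq_iff.1 h
  have hiff : ∀ j ≤ k, j ∈ missingLevels D m x ↔ j ∈ missingLevels D m y := fun j hj => by
    refine and_congr_right fun _ => forall_congr' fun z => imp_congr_left ?_
    exact forall₂_congr fun i hi => by rw [hxy i (by omega)]
  refine ⟨(hiff k le_rfl).2 hk.1, fun j hj => not_lt.1 fun hjk => ?_⟩
  exact hjk.not_ge (hk.2 ((hiff j hjk.le).1 hj))

theorem IsAlphaOne.closedCoverSelection {X : Set (ℕ → Bool)}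
    (h : IsAlphaOne (GerlitsNagySpace X)) : ClosedCoverSelection X := by
  intro D hDc hDm hDcov
  have hN : ∀ n, IsOrthogonal X (⋃ m, minimalMissingNodes (D n m) m) := fun n x hx => by
    obtain ⟨m₀, hm₀⟩ := hDcov n ⟨x, hx⟩
    have hsub : ∀ m, {k | initialSegment x k ∈ minimalMissingNodes (D n m) m}.Subsingleton :=
      fun m a ha b hb =>
        (initialSegment_mem_minimalMissingNodes (x := ⟨x, hx⟩).1 ha).unique
          (initialSegment_mem_minimalMissingNodes (x := ⟨x, hx⟩).1 hb)
    refine ((finite_Iio m₀).biUnion fun m _ => (hsub m).finite).subset fun k hk => ?_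
    obtain ⟨m, hm⟩ := mem_iUnion.1 hk
    refine mem_biUnion (x := m) (mem_Iio.2 (not_le.1 fun hle => ?_)) hm
    have hleast := initialSegment_mem_minimalMissingNodes (x := ⟨x, hx⟩).1 hm
    exact hleast.1.2 _ (fun _ _ => rfl) (hDm n hle hm₀)
  obtain ⟨T, hT, hfin⟩ := h.exists_isOrthogonal hN
  have hb : ∀ n, ∃ b, ∀ l ∈ ⋃ m, minimalMissingNodes (D n m) m, b ≤ l.length → l ∈ T := fun n => by
    obtain ⟨b, hb⟩ := ((hfin n).image List.length).bddAbove
    refine ⟨b + 1, fun l hl hbl => by_contra fun hlT => ?_⟩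
    have h1 := hb (mem_image_of_mem _ ⟨hl, hlT⟩)
    omega
  choose b hb using hb
  -- Taking `g n ≥ n` makes failures for infinitely many `n` yield infinitely many nodes in `T`.
  refine ⟨fun n => max n (b n), fun x => ?_⟩
  obtain ⟨c, hc⟩ := (hT x x.2).bddAbove
  filter_upwards [eventually_gt_atTop c] with n hn
  by_contra hx
  have hne := missingLevels_nonempty (hDc n _) (max n (b n)) hx
  have hleast : IsLeast (missingLevels (D n (max n (b n))) (max n (b n)) x) (sInf _) :=
    ⟨Nat.sInf_mem hne, fun _ hj => Nat.sInf_le hj⟩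
  have hge := hleast.1.1
  have hTk := hb n _ (mem_iUnion.2 ⟨_, initialSegment_mem_minimalMissingNodes.2 hleast⟩)
    (by rw [length_initialSegment]; omega)
  have h1 := hc hTk
  omega

theorem mainTheorem2 (X : Set (ℕ → Bool)) :
    IsAlphaOne (GerlitsNagySpace X) ↔ BorelImagesBounded X :=
  ⟨fun h => h.closedCoverSelection.borelImagesBounded, isAlphaOne_of_borelImagesBounded⟩
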